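/- Let $K$ be a field with a valuation $\operatorname{val}\colon K^*\to\mathbb R$, with valuation ring $R=\{0\}\cup\{a\in K^*:\operatorname{val}(a)\ge 0\}$, residue field $\Bbbk$ (write $\overline a\in\Bbbk$ for the class of $a\in R$) and value group $\Gamma=\operatorname{val}(K^*)\subseteq\mathbb R$. Assume that $\Gamma$ contains $\mathbb Q$ (so that $\Gamma$ is dense in $\mathbb R$) and is divisible (i.e. $\gamma/m\in\Gamma$ for all $\gamma\in\Gamma$ and all integers $m\ge1$), and that a splitting of the valuation is given, i.e. a group homomorphism $\Gamma\to K^*$, $\gamma\mapsto t^\gamma$, with $\operatorname{val}(t^\gamma)=\gamma$. For $w\in\Gamma^{n+1}$ and $0\ne f=\sum_u c_ux^u\in K[x_0,\dots,x_n]$ let $W=\min_{c_u\neq0}(\operatorname{val}(c_u)+w\cdot u)$ and $$\operatorname{in}_w(f)=\sum_{u:\,c_u\ne0}\overline{t^{\,w\cdot u-W}c_u}\;x^u\in\Bbbk[x_0,\dots,x_n],$$ let $\operatorname{in}_w(0)=0$, and for an ideal $I$ let $\operatorname{in}_w(I)=\langle \operatorname{in}_w(f):f\in I\rangle$. Let $C_I[w]=\{w'\in\Gamma^{n+1}:\operatorname{in}_{w'}(I)=\operatorname{in}_w(I)\}$,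 and let $\overline{C_I[w]}$ be its closure in $\mathbb R^{n+1}$ for the Euclidean topology. A polyhedron in $\mathbb R^{n+1}$ is a set $\{x: Ax\le b\}$ with $A$ a real $s\times(n+1)$ matrix and $b\in\mathbb R^s$; it is $\Gamma$-rational if it can be so written with $A$ rational and $b\in\Gamma^s$. A face of a polyhedron $P$ is a nonempty set of points of $P$ at which some linear functional attains its maximum over $P$. A polyhedral complex is a collection of polyhedra that contains all faces of its members and in which any two members intersect either in the empty set or in a common face; it is $\Gamma$-rational if all its members are. **Theorem.** For every $n\ge 0$ and every homogeneous ideal $I\subseteq K[x_0,\dots,x_n]$, the collection $\{\overline{C_I[w]}:w\in\Gamma^{n+1}\}$ is finite and is a $\Gamma$-rational polyhedral complex (the Gröbner complex of $I$). -/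

import Mathlib

namespace GrobnerComplex

/-! ### Valued fields

A real-valued valuation on a field `K` is `v : AddValuation K (WithTop ℝ)`; here `v a = ⊤` exactly
when `a = 0`. -/

section Valued

variable {K : Type*} [Field K]

/-- The value group `Γ ⊆ ℝ`, the image of `Kˣ` under the valuation. -/
def valueGroup (v : AddValuation K (WithTop ℝ)) : AddSubgroup ℝ where
  carrier := {r | ∃ a : K, v a = (r : WithTop ℝ)}
  zero_mem' := ⟨1, by simp⟩
  add_mem' := by
    rintro r s ⟨a, ha⟩ ⟨b, hb⟩
    exact ⟨a * b, by rw [v.map_mul, ha, hb, WithTop.coe_add]⟩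
  neg_mem' := by
    rintro r ⟨a, ha⟩
    exact ⟨a⁻¹, by rw [v.map_inv, ha]; rfl⟩

open Classical in
/-- The valuation of a nonzero element, as an element of `Γ` (and the irrelevant value `0` at `0`). -/
noncomputable def ord (v : AddValuation K (WithTop ℝ)) (a : K) : valueGroup v :=
  if h : a = 0 then 0
  else ⟨(v a).untop (v.ne_top_iff.2 h), a, (WithTop.coe_untop _ _).symm⟩

theorem coe_ord (v : AddValuation K (WithTop ℝ)) {a : K} (ha : a ≠ 0) :
    (((ord v a : valueGroup v) : ℝ) : WithTop ℝ) = v a := by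
  simp [ord, ha]

/-- The valuation ring `R = {a : v a ≥ 0}`. -/
noncomputable abbrev valRing (v : AddValuation K (WithTop ℝ)) : ValuationSubring K :=
  (AddValuation.toValuation v).valuationSubring

theorem mem_valRing (v : AddValuation K (WithTop ℝ)) {a : K} : a ∈ valRing v ↔ 0 ≤ v a :=
  Iff.rfl

/-- The residue field `R / 𝔪`. -/
abbrev ResField (v : AddValuation K (WithTop ℝ)) : Type _ :=
  IsLocalRing.ResidueField (valRing v)

open Classical in
/-- The residue class of an element of `R` (and the irrelevant value `0` outside `R`). -/
noncomputable def residue (v : AddValuation K (WithTop ℝ)) (a : K) : ResField v :=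
  if h : a ∈ valRing v then IsLocalRing.residue (valRing v) ⟨a, h⟩ else 0

/-- `φ` is a splitting `w ↦ t ^ w` of the valuation: a group homomorphism `Γ → Kˣ` with
`v (t ^ w) = w`. -/
def IsSplitting (v : AddValuation K (WithTop ℝ))
    (φ : Multiplicative (valueGroup v) →* Kˣ) : Prop :=
  ∀ γ : valueGroup v, v (φ (Multiplicative.ofAdd γ) : K) = ((γ : ℝ) : WithTop ℝ)

/-! ### Initial forms and initial ideals -/

variable {n : ℕ}

/-- The dot product `w · u` of a weight and an exponent vector. -/
def dot (v : AddValuation K (WithTop ℝ)) (w : Fin (n + 1) → valueGroup v)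
    (u : Fin (n + 1) →₀ ℕ) : valueGroup v :=
  ∑ i, u i • w i

open Classical in
/-- `trop f w = min (v c_u + w · u)`, over the exponents `u` with `c_u ≠ 0`, for
`f = ∑ c_u x ^ u ≠ 0` (and the irrelevant value `0` at `f = 0`). -/
noncomputable def trop (v : AddValuation K (WithTop ℝ)) (f : MvPolynomial (Fin (n + 1)) K)
    (w : Fin (n + 1) → valueGroup v) : valueGroup v :=
  if h : f.support.Nonempty then f.support.inf' h (fun u => ord v (f.coeff u) + dot v w u) else 0

/-- The initial form: with `W = trop f w`, it is the polynomial
`∑ (residue of t ^ (w · u - W) * c_u) x ^ u` over the residue field. -/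
noncomputable def initialForm (v : AddValuation K (WithTop ℝ))
    (φ : Multiplicative (valueGroup v) →* Kˣ) (w : Fin (n + 1) → valueGroup v)
    (f : MvPolynomial (Fin (n + 1)) K) : MvPolynomial (Fin (n + 1)) (ResField v) :=
  ∑ u ∈ f.support, MvPolynomial.monomial u
    (residue v ((φ (Multiplicative.ofAdd (dot v w u - trop v f w)) : K) * f.coeff u))

/-- The coefficients whose residues are taken in `initialForm` do lie in the valuation ring. -/
theorem initialForm_coeff_mem (v : AddValuation K (WithTop ℝ))
    (φ : Multiplicative (valueGroup v) →* Kˣ) (hφ : IsSplitting v φ)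
    (w : Fin (n + 1) → valueGroup v) (f : MvPolynomial (Fin (n + 1)) K)
    (u : Fin (n + 1) →₀ ℕ) (hu : u ∈ f.support) :
    (φ (Multiplicative.ofAdd (dot v w u - trop v f w)) : K) * f.coeff u ∈ valRing v := by
  have hW : trop v f w ≤ ord v (f.coeff u) + dot v w u := by
    rw [trop, dif_pos ⟨u, hu⟩]
    exact Finset.inf'_le _ hu
  rw [mem_valRing, v.map_mul, hφ, ← coe_ord v (MvPolynomial.mem_support_iff.1 hu),
    ← WithTop.coe_add, ← WithTop.coe_zero, WithTop.coe_le_coe]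
  have hW' : ((trop v f w : valueGroup v) : ℝ) ≤ ord v (f.coeff u) + dot v w u := hW
  rw [AddSubgroup.coe_sub]
  linarith

/-- The initial ideal `in_w(I)`, generated by the initial forms of all elements of `I`. -/
noncomputable def initialIdeal (v : AddValuation K (WithTop ℝ))
    (φ : Multiplicative (valueGroup v) →* Kˣ) (w : Fin (n + 1) → valueGroup v)
    (I : Ideal (MvPolynomial (Fin (n + 1)) K)) :
    Ideal (MvPolynomial (Fin (n + 1)) (ResField v)) :=
  Ideal.span (initialForm v φ w '' (I : Set (MvPolynomial (Fin (n + 1)) K)))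

/-- The set `C_I[w]` of all weights `w' ∈ Γ ^ (n + 1)` with `in_{w'}(I) = in_w(I)`, as a subset of
`ℝ ^ (n + 1)`. -/
def cell (v : AddValuation K (WithTop ℝ)) (φ : Multiplicative (valueGroup v) →* Kˣ)
    (I : Ideal (MvPolynomial (Fin (n + 1)) K)) (w : Fin (n + 1) → valueGroup v) :
    Set (Fin (n + 1) → ℝ) :=
  {x | ∃ w' : Fin (n + 1) → valueGroup v,
    (∀ i, x i = (w' i : ℝ)) ∧ initialIdeal v φ w' I = initialIdeal v φ w I}

/-- The collection `{closure C_I[w] : w ∈ Γ ^ (n + 1)}`. -/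
def grobnerComplex (v : AddValuation K (WithTop ℝ)) (φ : Multiplicative (valueGroup v) →* Kˣ)
    (I : Ideal (MvPolynomial (Fin (n + 1)) K)) : Set (Set (Fin (n + 1) → ℝ)) :=
  {P | ∃ w : Fin (n + 1) → valueGroup v, P = closure (cell v φ I w)}

attribute [local instance] MvPolynomial.gradedAlgebra

/-- A homogeneous ideal of `K[x_0, …, x_n]`, for the grading by total degree. -/
def IsHomogeneousIdeal (I : Ideal (MvPolynomial (Fin (n + 1)) K)) : Prop :=
  I.IsHomogeneous (MvPolynomial.homogeneousSubmodule (Fin (n + 1)) K)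

end Valued

/-! ### Polyhedra and polyhedral complexes in `ℝ ^ m` -/

/-- A polyhedron: a set of the form `{x | A x ≤ b}`. -/
def IsPolyhedron {m : ℕ} (P : Set (Fin m → ℝ)) : Prop :=
  ∃ (s : ℕ) (A : Matrix (Fin s) (Fin m) ℝ) (b : Fin s → ℝ), P = {x | A.mulVec x ≤ b}

/-- A `Γ`-rational polyhedron: a set of the form `{x | A x ≤ b}` with `A` rational and `b` having
entries in `Γ`. -/
def IsRationalPolyhedron {m : ℕ} (Γ : AddSubgroup ℝ) (P : Set (Fin m → ℝ)) : Prop :=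
  ∃ (s : ℕ) (A : Matrix (Fin s) (Fin m) ℚ) (b : Fin s → ℝ),
    (∀ i, b i ∈ Γ) ∧ P = {x | (A.map (fun q : ℚ => (q : ℝ))).mulVec x ≤ b}

/-- `F` is a (nonempty) face of `P`: the nonempty set of points of `P` at which some linear
functional attains its maximum on `P`. -/
def IsFace {m : ℕ} (P F : Set (Fin m → ℝ)) : Prop :=
  F.Nonempty ∧ ∃ l : (Fin m → ℝ) →ₗ[ℝ] ℝ, F = {x ∈ P | ∀ y ∈ P, l y ≤ l x}

/-- A polyhedral complex: a collection of polyhedra that contains all (nonempty) faces of its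
members and in which any two members meet in the empty set or in a common face. -/
structure IsPolyhedralComplex {m : ℕ} (S : Set (Set (Fin m → ℝ))) : Prop where
  polyhedron : ∀ P ∈ S, IsPolyhedron P
  face_mem : ∀ P ∈ S, ∀ F, IsFace P F → F ∈ S
  inter_face : ∀ P ∈ S, ∀ Q ∈ S, P ∩ Q = ∅ ∨ (IsFace P (P ∩ Q) ∧ IsFace Q (P ∩ Q))

end GrobnerComplex

/-! The proof identifies the Gröbner complex with the linearity complex of one tropical polynomial,
built from Plücker coordinates of a truncation of `I`.

Fix a degree `d`. The elements of `I` of degree at most `d` form a finite-dimensional space `V`, and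
the corresponding part of `in_w(I)` is the initial space of `V` for the weights `w · u` on its
coordinates (`trunc_initialIdeal`; homogeneity enters here). By Cramer's rule the reduced echelon
matrix of `V` with pivots `J` has ratios of Plücker coordinates as entries. If `J` minimises `ord
p_J + ∑ j, ω (J j)`, the rescaled matrix is integral, and its reduction, which has an identity block
at `J`, spans the initial space. Hence initial spaces all have the dimension of `V`, and two of them
agree exactly when the same `J` are minimising (`initialSpace_eq_iff`).

One degree suffices for all `w`: the initial ideals share a Hilbert function and have finitely many
truncations in each degree, so an ultrafilter limit together with noetherianity yields a `d` in
which truncations determine the ideals (`exists_trunc_determines`).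

Thus `C_I[w]` consists of the `Γ`-points with a prescribed set of minimising terms among finitely
many affine functions with integer slopes and constants in `Γ`. Since `Γ` is divisible and contains
`ℚ`, these points are dense in the real locus (`closure_minSet_eq`), and the closures are the cells
of a linearity complex, whose faces can be treated directly. -/

namespace GrobnerComplex

open Filter Topology

/-! ### Approximation by points with coordinates in a dense divisible group -/

/-- A real vector can be approximated by vectors with entries in a divisible group `Γ ⊇ ℚ` that
satisfy every rational linear equation with right-hand side in `Γ` satisfied by the given one. -/
theorem exists_mem_nhds_rational_relations {m : ℕ} (Γ : AddSubgroup ℝ)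
    (h_rat : ∀ q : ℚ, (q : ℝ) ∈ Γ) (h_div : ∀ γ ∈ Γ, ∀ m : ℕ, 0 < m → γ / (m : ℝ) ∈ Γ)
    (y : Fin m → ℝ) {N : Set (Fin m → ℝ)} (hN : N ∈ 𝓝 y) :
    ∃ w ∈ N, (∀ i, w i ∈ Γ) ∧ ∀ (a : Fin m → ℚ), ∀ c ∈ Γ,
      ∑ i, (a i : ℝ) * y i = c → ∑ i, (a i : ℝ) * w i = c := by
  -- Divisibility makes `Γ` a `ℚ`-subspace of `ℝ`, so it has a complement `C`.
  let G : Submodule ℚ ℝ :=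
    { Γ with
      smul_mem' := by
        intro q x hx
        have h := h_div _ (Γ.zsmul_mem hx q.num) q.den q.den_pos
        have e : q • x = (q.num • x) / (q.den : ℝ) := by
          rw [Rat.smul_def, zsmul_eq_mul]
          conv_lhs => rw [← Rat.num_div_den q]
          push_cast
          ring
        exact e ▸ h }
  obtain ⟨C, hC⟩ := Submodule.exists_isCompl G
  let b := Module.Basis.ofVectorSpace ℚ C
  -- `f q` is the `ℚ`-linear map that fixes `Γ` and moves each basis vector `b j` of `C` to `q j`.
  -- It preserves rational relations with constants in `Γ`, gives back `y` at `q = b`, and has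
  -- values in `Γ` when `q` is rational; a rational `q` close to `b` is therefore what is needed.
  let f : (Module.Basis.ofVectorSpaceIndex ℚ C → ℝ) → ℝ →ₗ[ℚ] ℝ := fun q =>
    LinearMap.ofIsCompl hC G.subtype (b.constr ℚ q)
  have hdec : ∀ x : ℝ, ∃ (g : G) (c : C), x = g + c := by
    intro x
    have hx : x ∈ G ⊔ C := by rw [hC.sup_eq_top]; trivial
    obtain ⟨g, hg, c, hc, e⟩ := Submodule.mem_sup.1 hx
    exact ⟨⟨g, hg⟩, ⟨c, hc⟩, e.symm⟩
  have hf : ∀ q (g : G) (c : C), f q (g + c) = g + (b.repr c).sum fun j r => r • q j := by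
    intro q g c
    simp only [f, map_add, LinearMap.ofIsCompl_apply_left, LinearMap.ofIsCompl_apply_right]
    simp [Module.Basis.constr_apply]
  have hcont : Continuous fun q => fun i => f q (y i) := by
    refine continuous_pi fun i => ?_
    obtain ⟨g, c, e⟩ := hdec (y i)
    simp only [e, hf, Finsupp.sum]
    refine continuous_const.add (continuous_finsetSum _ fun j _ => ?_)
    simp only [Rat.smul_def]
    fun_prop
  have hid : (fun i => f (fun j => (b j : ℝ)) (y i)) = y := by
    funext i
    obtain ⟨g, c, e⟩ := hdec (y i)
    rw [e, hf]
    congr 1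
    have h := congrArg C.subtype (b.linearCombination_repr c)
    rw [Finsupp.linearCombination_apply, map_finsuppSum] at h
    simpa using h
  have hdense : DenseRange fun (r : Module.Basis.ofVectorSpaceIndex ℚ C → ℚ) =>
      fun j => ((r j : ℚ) : ℝ) :=
    DenseRange.piMap fun _ => Rat.denseRange_cast
  have hpre : (fun q => fun i => f q (y i)) ⁻¹' N ∈ 𝓝 fun j => (b j : ℝ) :=
    hcont.continuousAt.preimage_mem_nhds (by rw [hid]; exact hN)
  obtain ⟨U, hUN, hU, hbU⟩ := mem_nhds_iff.1 hpre
  obtain ⟨r, hr⟩ := hdense.exists_mem_open hU ⟨_, hbU⟩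
  refine ⟨_, hUN hr, fun i => ?_, fun a c hc h => ?_⟩
  · obtain ⟨g, c, e⟩ := hdec (y i)
    simp only [e, hf]
    refine Γ.add_mem g.2 (G.sum_mem fun j _ => G.smul_mem _ (h_rat _))
  · set q : Module.Basis.ofVectorSpaceIndex ℚ C → ℝ := fun j => ((r j : ℚ) : ℝ)
    have h1 : f q c = c := by
      have := hf q ⟨c, hc⟩ 0
      simpa using this
    have h2 : f q (∑ i, (a i : ℝ) * y i) = ∑ i, (a i : ℝ) * f q (y i) := by
      rw [map_sum]
      refine Finset.sum_congr rfl fun i _ => ?_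
      rw [← Rat.smul_def, map_smul, Rat.smul_def]
    rw [← h2, h, h1]

/-! ### The linearity complex of a minimum of affine functions -/

section Linearity

variable {T : Type*} {m : ℕ} (a : T → Fin m → ℚ) (b : T → ℝ)

/-- The affine function with slope `a J` and constant term `b J`. -/
def affineForm (J : T) (x : Fin m → ℝ) : ℝ := b J + ∑ i, (a J i : ℝ) * x i

/-- The indices at which the minimum of the affine functions is attained. -/
def minSet (x : Fin m → ℝ) : Set T := {J | ∀ J', affineForm a b J x ≤ affineForm a b J' x}

/-- The points at which all the affine functions with index in `A` attain the minimum. -/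
def linearityCell (A : Set T) : Set (Fin m → ℝ) := {x | A ⊆ minSet a b x}

variable {a b}

theorem affineForm_lineMap (J : T) (x y : Fin m → ℝ) (s : ℝ) :
    affineForm a b J (x + s • (y - x)) =
      affineForm a b J x + s * (affineForm a b J y - affineForm a b J x) := by
  simp only [affineForm, Pi.add_apply, Pi.smul_apply, Pi.sub_apply, smul_eq_mul, mul_add,
    Finset.sum_add_distrib]
  have : ∑ i, (a J i : ℝ) * (s * (y i - x i)) =
      s * (∑ i, (a J i : ℝ) * y i - ∑ i, (a J i : ℝ) * x i) := by
    rw [← Finset.sum_sub_distrib, Finset.mul_sum]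
    exact Finset.sum_congr rfl fun i _ => by ring
  rw [this]
  ring

@[fun_prop]
theorem continuous_affineForm (J : T) : Continuous (affineForm a b J) := by
  unfold affineForm
  fun_prop

theorem minSet_nonempty [Finite T] [Nonempty T] (x : Fin m → ℝ) : (minSet a b x).Nonempty :=
  Finite.exists_min fun J => affineForm a b J x

theorem affineForm_eq_of_mem_minSet {J J' : T} {x : Fin m → ℝ} (h : J ∈ minSet a b x)
    (h' : J' ∈ minSet a b x) : affineForm a b J x = affineForm a b J' x :=
  le_antisymm (h _) (h' _)

theorem mem_minSet_iff {J J' : T} {x : Fin m → ℝ} (h : J ∈ minSet a b x) :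
    J' ∈ minSet a b x ↔ affineForm a b J' x = affineForm a b J x :=
  ⟨fun h' => affineForm_eq_of_mem_minSet h' h, fun e J'' => e ▸ h J''⟩

theorem isClosed_linearityCell (A : Set T) : IsClosed (linearityCell a b A) := by
  have : linearityCell a b A =
      ⋂ J ∈ A, ⋂ J', {x | affineForm a b J x ≤ affineForm a b J' x} := by
    ext x
    simp [linearityCell, minSet, Set.subset_def]
  rw [this]
  exact isClosed_biInter fun J _ => isClosed_iInter fun J' =>
    isClosed_le (continuous_affineForm J) (continuous_affineForm J')

/-- On a segment with common minimum index, the minimum set at an interior point is the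
intersection of those at the ends. -/
theorem minSet_lineMap {J₀ : T} {x y : Fin m → ℝ} (hx : J₀ ∈ minSet a b x)
    (hy : J₀ ∈ minSet a b y) {s : ℝ} (hs : 0 < s) (hs' : s < 1) :
    minSet a b (x + s • (y - x)) = minSet a b x ∩ minSet a b y := by
  have h₀ : J₀ ∈ minSet a b (x + s • (y - x)) := by
    intro J
    rw [affineForm_lineMap, affineForm_lineMap]
    nlinarith [hx J, hy J, mul_nonneg hs.le (sub_nonneg.2 (hy J)),
      mul_nonneg (sub_pos.2 hs').le (sub_nonneg.2 (hx J))]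
  ext J
  rw [Set.mem_inter_iff, mem_minSet_iff h₀, mem_minSet_iff hx, mem_minSet_iff hy,
    affineForm_lineMap, affineForm_lineMap]
  constructor
  · intro e
    have h1 := mul_nonneg hs.le (sub_nonneg.2 (hy J))
    have h2 := mul_nonneg (sub_pos.2 hs').le (sub_nonneg.2 (hx J))
    have h3 : s * (affineForm a b J y - affineForm a b J₀ y) = 0 := by nlinarith
    have h4 : (1 - s) * (affineForm a b J x - affineForm a b J₀ x) = 0 := by nlinarith
    rcases mul_eq_zero.1 h3 with h | h
    · linarith
    rcases mul_eq_zero.1 h4 with h' | h'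
    · linarith
    constructor <;> linarith
  · rintro ⟨e, e'⟩
    rw [e, e']

/-- A point is relatively interior to its own cell: the segment from `y` can be prolonged slightly
beyond `x`. Terms minimal at `x` are tied at both points, hence on the whole line, and the finitely
many others stay larger near `x`. -/
theorem lineMap_mem_linearityCell [Finite T] {x y : Fin m → ℝ}
    (hne : (minSet a b x).Nonempty) (h : minSet a b x ⊆ minSet a b y) :
    ∃ s : ℝ, 0 < s ∧ x + (-s) • (y - x) ∈ linearityCell a b (minSet a b x) := by
  obtain ⟨J₀, hJ₀⟩ := hne
  have key : ∀ᶠ s in 𝓝[>] (0 : ℝ), ∀ J, J ∉ minSet a b x →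
      affineForm a b J₀ (x + (-s) • (y - x)) < affineForm a b J (x + (-s) • (y - x)) := by
    rw [eventually_all]
    intro J
    by_cases hJ : J ∈ minSet a b x
    · exact Eventually.of_forall fun s h => absurd hJ h
    have hlt : affineForm a b J₀ x < affineForm a b J x :=
      lt_of_le_of_ne (hJ₀ J) fun e => hJ ((mem_minSet_iff hJ₀).2 e.symm)
    have hc : ∀ J, Tendsto (fun s : ℝ => affineForm a b J (x + (-s) • (y - x))) (𝓝[>] 0)
        (𝓝 (affineForm a b J x)) := by
      intro J
      have : Continuous fun s : ℝ => affineForm a b J (x + (-s) • (y - x)) := by fun_prop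
      have h0 := this.tendsto 0
      simp only [neg_zero, zero_smul, add_zero] at h0
      exact h0.mono_left nhdsWithin_le_nhds
    filter_upwards [(hc J₀).eventually_lt (hc J) hlt] with s hs _ using hs
  obtain ⟨s, hs, hs0⟩ := (key.and self_mem_nhdsWithin).exists
  refine ⟨s, hs0, fun J hJ J' => ?_⟩
  have e : affineForm a b J (x + (-s) • (y - x)) = affineForm a b J₀ (x + (-s) • (y - x)) := by
    rw [affineForm_lineMap, affineForm_lineMap, affineForm_eq_of_mem_minSet hJ hJ₀,
      affineForm_eq_of_mem_minSet (h hJ) (h hJ₀)]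
  rw [e]
  by_cases hJ' : J' ∈ minSet a b x
  · rw [affineForm_lineMap, affineForm_lineMap, affineForm_eq_of_mem_minSet hJ' hJ₀,
      affineForm_eq_of_mem_minSet (h hJ') (h hJ₀)]
  · exact (hs J' hJ').le

/-- Near every point there is a point with coordinates in `Γ` and with the same minimum set. -/
theorem exists_minSet_eq [Finite T] [Nonempty T] (Γ : AddSubgroup ℝ)
    (h_rat : ∀ q : ℚ, (q : ℝ) ∈ Γ) (h_div : ∀ γ ∈ Γ, ∀ m : ℕ, 0 < m → γ / (m : ℝ) ∈ Γ)
    (hb : ∀ J, b J ∈ Γ) (y : Fin m → ℝ) {N : Set (Fin m → ℝ)} (hN : N ∈ 𝓝 y) :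
    ∃ w ∈ N, (∀ i, w i ∈ Γ) ∧ minSet a b w = minSet a b y := by
  obtain ⟨J₀, hJ₀⟩ := minSet_nonempty (a := a) (b := b) y
  have key : ∀ᶠ z in 𝓝 y, ∀ J, J ∉ minSet a b y → affineForm a b J₀ z < affineForm a b J z := by
    rw [eventually_all]
    intro J
    by_cases hJ : J ∈ minSet a b y
    · exact Eventually.of_forall fun s h => absurd hJ h
    have hlt : affineForm a b J₀ y < affineForm a b J y :=
      lt_of_le_of_ne (hJ₀ J) fun e => hJ ((mem_minSet_iff hJ₀).2 e.symm)
    filter_upwards [((continuous_affineForm J₀).tendsto y).eventually_lt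
      ((continuous_affineForm J).tendsto y) hlt] with z hz _ using hz
  -- The strict inequalities are open and go into the neighbourhood; the ties are rational relations
  -- with constants in `Γ`, which the approximation preserves.
  obtain ⟨w, ⟨hwN, hw⟩, hwΓ, hrel⟩ :=
    exists_mem_nhds_rational_relations Γ h_rat h_div y (inter_mem hN key)
  refine ⟨w, hwN, hwΓ, ?_⟩
  have heq : ∀ J ∈ minSet a b y, affineForm a b J w = affineForm a b J₀ w := by
    intro J hJ
    have e := affineForm_eq_of_mem_minSet hJ hJ₀
    have hsub : ∀ x : Fin m → ℝ, ∑ i, ((a J i - a J₀ i : ℚ) : ℝ) * x i =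
        ∑ i, (a J i : ℝ) * x i - ∑ i, (a J₀ i : ℝ) * x i := by
      intro x
      rw [← Finset.sum_sub_distrib]
      exact Finset.sum_congr rfl fun i _ => by push_cast; ring
    have h := hrel (fun i => a J i - a J₀ i) (b J₀ - b J) (Γ.sub_mem (hb _) (hb _)) (by
      rw [hsub]
      simp only [affineForm] at e
      linarith)
    rw [hsub] at h
    simp only [affineForm]
    linarith
  have h₀ : J₀ ∈ minSet a b w := by
    intro J
    by_cases hJ : J ∈ minSet a b y
    · exact (heq J hJ).ge
    · exact (hw J hJ).le
  ext J
  rw [mem_minSet_iff h₀]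
  refine ⟨fun e => ?_, heq J⟩
  by_contra hJ
  exact (hw J hJ).ne' e

/-- A point `x` of the cell, pushed slightly towards `y`, acquires exactly the minimum set of `y`; a
nearby `Γ`-point then has it too. -/
theorem closure_minSet_eq [Finite T] [Nonempty T] (Γ : AddSubgroup ℝ)
    (h_rat : ∀ q : ℚ, (q : ℝ) ∈ Γ) (h_div : ∀ γ ∈ Γ, ∀ m : ℕ, 0 < m → γ / (m : ℝ) ∈ Γ)
    (hb : ∀ J, b J ∈ Γ) (y : Fin m → ℝ) :
    closure {x | (∀ i, x i ∈ Γ) ∧ minSet a b x = minSet a b y} =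
      linearityCell a b (minSet a b y) := by
  refine subset_antisymm (closure_minimal (fun x hx => hx.2.ge) (isClosed_linearityCell _)) ?_
  intro x hx
  obtain ⟨J₀, hJ₀⟩ := minSet_nonempty (a := a) (b := b) y
  rw [mem_closure_iff_nhds]
  intro N hN
  have hlim : Tendsto (fun s : ℝ => x + s • (y - x)) (𝓝[>] 0) (𝓝 x) := by
    have : Continuous fun s : ℝ => x + s • (y - x) := by fun_prop
    have h0 := this.tendsto 0
    simp only [zero_smul, add_zero] at h0
    exact h0.mono_left nhdsWithin_le_nhds
  obtain ⟨s, hsN, hs0, hs1⟩ := ((hlim.eventually (eventually_mem_nhds_iff.2 hN)).and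
    (Ioo_mem_nhdsGT (show (0 : ℝ) < 1 by norm_num))).exists
  obtain ⟨w, hwN, hwΓ, hw⟩ := exists_minSet_eq (a := a) (b := b) Γ h_rat h_div hb _ hsN
  refine ⟨w, hwN, hwΓ, ?_⟩
  rw [hw, minSet_lineMap (hx hJ₀) hJ₀ hs0 hs1]
  exact Set.inter_eq_right.2 hx

theorem isFace_linearityCell_inter [Finite T] {A B : Set T} (hA : A.Nonempty)
    (hne : (linearityCell a b A ∩ linearityCell a b B).Nonempty) :
    IsFace (linearityCell a b A) (linearityCell a b A ∩ linearityCell a b B) := by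
  classical
  have := Fintype.ofFinite T
  obtain ⟨J₀, hJ₀⟩ := hA
  -- Up to a constant, `l` sums the differences between the minimum and the forms indexed by `B`.
  -- Each difference is nonpositive on the cell of `A`, and all vanish exactly on the cell of `B`.
  let l : (Fin m → ℝ) →ₗ[ℝ] ℝ :=
    ∑ J ∈ B.toFinset, ∑ i, ((a J₀ i - a J i : ℚ) : ℝ) • LinearMap.proj i
  have hl : ∀ x, l x = ∑ J ∈ B.toFinset, (affineForm a b J₀ x - affineForm a b J x) -
      ∑ J ∈ B.toFinset, (b J₀ - b J) := by
    intro x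
    simp only [l, LinearMap.sum_apply, LinearMap.smul_apply, LinearMap.proj_apply, smul_eq_mul]
    rw [← Finset.sum_sub_distrib]
    refine Finset.sum_congr rfl fun J _ => ?_
    have : ∑ i, ((a J₀ i - a J i : ℚ) : ℝ) * x i =
        ∑ i, (a J₀ i : ℝ) * x i - ∑ i, (a J i : ℝ) * x i := by
      rw [← Finset.sum_sub_distrib]
      exact Finset.sum_congr rfl fun i _ => by push_cast; ring
    rw [this]
    simp only [affineForm]
    ring
  have hle : ∀ x ∈ linearityCell a b A, ∀ J ∈ B.toFinset,
      affineForm a b J₀ x - affineForm a b J x ≤ 0 := fun x hx J _ => by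
    linarith [hx hJ₀ J]
  have hB : ∀ x ∈ linearityCell a b A, (x ∈ linearityCell a b B ↔
      ∑ J ∈ B.toFinset, (affineForm a b J₀ x - affineForm a b J x) = 0) := by
    intro x hx
    rw [Finset.sum_eq_zero_iff_of_nonpos (hle x hx)]
    refine ⟨fun h J hJ => ?_, fun h J hJ => ?_⟩
    · rw [affineForm_eq_of_mem_minSet (hx hJ₀) (h (Set.mem_toFinset.1 hJ)), sub_self]
    · exact (mem_minSet_iff (hx hJ₀)).2 (sub_eq_zero.1 (h J (Set.mem_toFinset.2 hJ))).symm
  obtain ⟨z, hzA, hzB⟩ := hne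
  refine ⟨⟨z, hzA, hzB⟩, l, ?_⟩
  ext x
  refine and_congr_right fun hx => ?_
  rw [hB x hx]
  constructor
  · intro e y hy
    rw [hl, hl, e]
    linarith [Finset.sum_nonpos (hle y hy)]
  · intro h
    have h1 := h z hzA
    rw [hl, hl, (hB z hzA).1 hzB] at h1
    linarith [Finset.sum_nonpos (hle x hx)]

/-- Take `y` in the face with the fewest minimal terms. For `z` in the face, the midpoint lies in
the face and its minimum set is the intersection of the two, so minimality forces every term minimal
at `y` to be minimal at `z`. -/
theorem exists_eq_linearityCell_of_isFace [Finite T] {A : Set T} (hA : A.Nonempty)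
    {F : Set (Fin m → ℝ)} (hF : IsFace (linearityCell a b A) F) :
    ∃ y, F = linearityCell a b (minSet a b y) := by
  obtain ⟨J₀, hJ₀⟩ := hA
  obtain ⟨hne, l, hl⟩ := hF
  obtain ⟨y, hyF, hmin⟩ :=
    (measure fun y : Fin m → ℝ => (minSet a b y).ncard).wf.has_min F hne
  have hF' : ∀ z ∈ F, z ∈ linearityCell a b A := fun z hz => by rw [hl] at hz; exact hz.1
  have hy : y ∈ {x ∈ linearityCell a b A | ∀ y ∈ linearityCell a b A, l y ≤ l x} := hl ▸ hyF
  refine ⟨y, subset_antisymm (fun z hz => ?_) fun z hz => ?_⟩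
  · have hzA := hF' z hz
    have hmid := minSet_lineMap (hy.1 hJ₀) (hzA hJ₀) (s := 1 / 2) (by norm_num) (by norm_num)
    have hmem : y + (1 / 2 : ℝ) • (z - y) ∈ F := by
      rw [hl] at hz ⊢
      refine ⟨fun J hJ => ?_, fun x hx => ?_⟩
      · rw [hmid]
        exact ⟨hy.1 hJ, hzA hJ⟩
      · have h1 := hy.2 x hx
        have h2 := hz.2 x hx
        simp only [map_add, map_smul, map_sub, smul_eq_mul]
        linarith
    have h : (minSet a b y).ncard ≤ (minSet a b (y + (1 / 2 : ℝ) • (z - y))).ncard := not_lt.1 (hmin _ hmem)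
    rw [hmid] at h
    have := Set.eq_of_subset_of_ncard_le Set.inter_subset_left h (Set.toFinite _)
    exact Set.inter_eq_left.1 this
  · rw [hl]
    have hzA : z ∈ linearityCell a b A := fun J hJ => hz (hy.1 hJ)
    refine ⟨hzA, fun x hx => (hy.2 x hx).trans ?_⟩
    -- Beyond `y`, away from `z`, the line is still in the polyhedron, where `l` cannot exceed `l
    -- y`; hence `l z` is at least `l y`.
    obtain ⟨s, hs, hmem⟩ := lineMap_mem_linearityCell ⟨J₀, hy.1 hJ₀⟩ hz
    have h := hy.2 _ fun J hJ => hmem (hy.1 hJ)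
    simp only [map_add, map_smul, map_sub, smul_eq_mul] at h
    have : 0 ≤ s * (l z - l y) := by linarith
    linarith [nonneg_of_mul_nonneg_right this hs]

theorem isRationalPolyhedron_linearityCell [Finite T] (Γ : AddSubgroup ℝ) (hb : ∀ J, b J ∈ Γ)
    (A : Set T) : IsRationalPolyhedron Γ (linearityCell a b A) := by
  let e := Finite.equivFin {p : T × T // p.1 ∈ A}
  refine ⟨_, Matrix.of fun k i => a (e.symm k).1.1 i - a (e.symm k).1.2 i,
    fun k => b (e.symm k).1.2 - b (e.symm k).1.1, fun k => Γ.sub_mem (hb _) (hb _), ?_⟩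
  ext x
  have hrow : ∀ J J', affineForm a b J x ≤ affineForm a b J' x ↔
      ∑ i, ((a J i - a J' i : ℚ) : ℝ) * x i ≤ b J' - b J := by
    intro J J'
    have : ∑ i, ((a J i - a J' i : ℚ) : ℝ) * x i =
        ∑ i, (a J i : ℝ) * x i - ∑ i, (a J' i : ℝ) * x i := by
      rw [← Finset.sum_sub_distrib]
      exact Finset.sum_congr rfl fun i _ => by push_cast; ring
    rw [this]
    simp only [affineForm]
    constructor <;> intro h <;> linarith
  simp only [linearityCell, minSet, Set.mem_ofPred_eq, Pi.le_def, Matrix.mulVec, dotProduct,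
    Matrix.map_apply, Matrix.of_apply]
  constructor
  · exact fun h k => (hrow _ _).1 (h (e.symm k).2 _)
  · intro h J hJ J'
    have := h (e ⟨(J, J'), hJ⟩)
    rw [e.symm_apply_apply] at this
    exact (hrow _ _).2 this

theorem IsRationalPolyhedron.isPolyhedron {Γ : AddSubgroup ℝ} {P : Set (Fin m → ℝ)}
    (h : IsRationalPolyhedron Γ P) : IsPolyhedron P := by
  obtain ⟨s, A, c, _, hP⟩ := h
  exact ⟨s, _, c, hP⟩

theorem isPolyhedralComplex_linearityCell [Finite T] [Nonempty T] :
    IsPolyhedralComplex (Set.range fun y => linearityCell a b (minSet a b y)) where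
  polyhedron := by
    rintro _ ⟨y, rfl⟩
    -- The constants `b` are arbitrary reals here, so the value group is taken to be all of `ℝ`.
    exact (isRationalPolyhedron_linearityCell ⊤ (fun _ => trivial) _).isPolyhedron
  face_mem := by
    rintro _ ⟨y, rfl⟩ F hF
    obtain ⟨z, hz⟩ := exists_eq_linearityCell_of_isFace (minSet_nonempty y) hF
    exact ⟨z, hz.symm⟩
  inter_face := by
    rintro _ ⟨y, rfl⟩ _ ⟨z, rfl⟩
    refine (Set.eq_empty_or_nonempty _).imp_right fun h =>
      ⟨isFace_linearityCell_inter (minSet_nonempty y) h, ?_⟩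
    rw [Set.inter_comm] at h ⊢
    exact isFace_linearityCell_inter (minSet_nonempty z) h

end Linearity

end GrobnerComplex

namespace GrobnerComplex

open Module

/-! ### Plücker coordinates and reduced echelon bases -/

section Plucker

variable {K : Type*} [Field K] {ι : Type*} (V : Submodule K (ι → K))

/-- The maximal minor, with columns `J`, of a matrix whose rows form a basis of `V`. -/
noncomputable def plucker [Finite ι] (J : Fin (finrank K V) → ι) : K :=
  (Matrix.of fun i j => (finBasis K V i : ι → K) (J j)).det

variable [Finite ι]

/-- Row rank equals column rank, so as many independent columns as basis vectors can be selected. -/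
theorem exists_plucker_ne_zero : ∃ J, plucker V J ≠ 0 := by
  have := Fintype.ofFinite ι
  set A : Matrix (Fin (finrank K V)) ι K := Matrix.of fun i => (finBasis K V i : ι → K) with hA
  have hli : LinearIndependent K A.row :=
    (finBasis K V).linearIndependent.map' V.subtype V.ker_subtype
  have hrank : finrank K (Submodule.span K (Set.range A.col)) = finrank K V := by
    rw [← Matrix.rank_eq_finrank_span_cols, hli.rank_matrix, Fintype.card_fin]
  have h := Submodule.exists_fun_fin_finrank_span_eq K (Set.range A.col)
  rw [hrank] at h
  obtain ⟨f, hf, -, hfli⟩ := h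
  choose J hJ using hf
  refine ⟨J, ?_⟩
  have : (Matrix.of fun i j => (finBasis K V i : ι → K) (J j)).col = f := by
    funext j
    rw [← hJ]
    rfl
  rw [← this, Matrix.linearIndependent_cols_iff_isUnit, Matrix.isUnit_iff_isUnit_det] at hfli
  exact hfli.ne_zero

variable {V}

/-- The reduced echelon matrix of `V` with pivots `J`: by Cramer's rule its entries are ratios of
Plücker coordinates. -/
noncomputable def echelon (J : Fin (finrank K V) → ι) (i : Fin (finrank K V)) (u : ι) : K :=
  plucker V (Function.update J i u) / plucker V J

variable {J : Fin (finrank K V) → ι} (hJ : plucker V J ≠ 0)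
include hJ

theorem basis_eq_sum_echelon (i : Fin (finrank K V)) (u : ι) :
    (finBasis K V i : ι → K) u = ∑ j, (finBasis K V i : ι → K) (J j) * echelon J j u := by
  set A : Matrix (Fin (finrank K V)) (Fin (finrank K V)) K :=
    Matrix.of fun i j => (finBasis K V i : ι → K) (J j) with hA
  have h := congrFun (Matrix.mulVec_cramer A fun i => (finBasis K V i : ι → K) u) i
  have hc : ∀ j, A.cramer (fun i => (finBasis K V i : ι → K) u) j =
      plucker V (Function.update J j u) := by
    intro j
    rw [Matrix.cramer_apply, plucker]
    congr 1
    ext i' j'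
    by_cases e : j' = j
    · subst e; simp
    · simp [Matrix.updateCol_ne e, Function.update_of_ne e, hA]
  simp only [Matrix.mulVec, dotProduct, hc, Pi.smul_apply, smul_eq_mul] at h
  have hdet : A.det = plucker V J := rfl
  rw [hdet] at h
  simp only [echelon, ← mul_div_assoc]
  rw [← Finset.sum_div, eq_div_iff hJ, mul_comm, ← h]
  rfl

theorem eq_sum_echelon {c : ι → K} (hc : c ∈ V) (u : ι) :
    c u = ∑ j, c (J j) * echelon J j u := by
  have hrep : ∀ u, c u = ∑ i, (finBasis K V).repr ⟨c, hc⟩ i * (finBasis K V i : ι → K) u := by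
    intro u
    have h := congrFun (congrArg V.subtype ((finBasis K V).sum_repr ⟨c, hc⟩)) u
    rw [map_sum, Finset.sum_apply] at h
    exact h.symm
  rw [hrep u]
  simp only [hrep (J _), Finset.sum_mul]
  rw [Finset.sum_comm]
  refine Finset.sum_congr rfl fun i _ => ?_
  rw [basis_eq_sum_echelon hJ, Finset.mul_sum]
  exact Finset.sum_congr rfl fun j _ => by ring

/-- The basis matrix factors as its block at `J` times the echelon matrix. -/
theorem plucker_eq_mul_det (J' : Fin (finrank K V) → ι) :
    plucker V J' = plucker V J * (Matrix.of fun i j => echelon J i (J' j)).det := by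
  rw [plucker, plucker, ← Matrix.det_mul]
  congr 1
  ext i j
  simp only [Matrix.of_apply, Matrix.mul_apply]
  exact basis_eq_sum_echelon hJ i _

theorem echelon_pivot (i j : Fin (finrank K V)) :
    echelon J i (J j) = (1 : Matrix _ _ K) i j := by
  set A : Matrix (Fin (finrank K V)) (Fin (finrank K V)) K :=
    Matrix.of fun i j => (finBasis K V i : ι → K) (J j) with hA
  have h : A * Matrix.of (fun i j => echelon J i (J j)) = A * 1 := by
    ext i j
    rw [mul_one]
    simp only [hA, Matrix.of_apply, Matrix.mul_apply]
    exact (basis_eq_sum_echelon hJ i _).symm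
  have hu : IsUnit A := (Matrix.isUnit_iff_isUnit_det A).2 (isUnit_iff_ne_zero.2 hJ)
  exact congrFun (congrFun (hu.mul_left_cancel h) i) j

theorem echelon_mem (i : Fin (finrank K V)) : echelon J i ∈ V := by
  set A : Matrix (Fin (finrank K V)) (Fin (finrank K V)) K :=
    Matrix.of fun i j => (finBasis K V i : ι → K) (J j) with hA
  have hu : IsUnit A.det := isUnit_iff_ne_zero.2 hJ
  have h : echelon J i = ∑ k, A⁻¹ i k • (finBasis K V k : ι → K) := by
    funext u
    simp only [Finset.sum_apply, Pi.smul_apply, smul_eq_mul]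
    have e : ∀ k, (finBasis K V k : ι → K) u = (A.mulVec fun j => echelon J j u) k :=
      fun k => basis_eq_sum_echelon hJ k u
    simp only [e]
    change _ = (A⁻¹.mulVec (A.mulVec fun j => echelon J j u)) i
    rw [Matrix.mulVec_mulVec, Matrix.nonsing_inv_mul _ hu, Matrix.one_mulVec]
  rw [h]
  exact V.sum_mem fun k _ => V.smul_mem _ (finBasis K V k).2

end Plucker

/-! ### Valuations of elements -/

section Valued

variable {K : Type*} [Field K] (v : AddValuation K (WithTop ℝ))

theorem ord_eq_of_coe {a : K} {γ : valueGroup v} (h : v a = ((γ : ℝ) : WithTop ℝ)) :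
    ord v a = γ := by
  have ha : a ≠ 0 := v.ne_top_iff.1 (by rw [h]; exact WithTop.coe_ne_top)
  rw [← coe_ord v ha] at h
  exact Subtype.ext (WithTop.coe_injective h)

theorem ord_mul {a b : K} (ha : a ≠ 0) (hb : b ≠ 0) : ord v (a * b) = ord v a + ord v b := by
  refine ord_eq_of_coe v ?_
  rw [v.map_mul, ← coe_ord v ha, ← coe_ord v hb, ← WithTop.coe_add]
  rfl

theorem ord_div {a b : K} (ha : a ≠ 0) (hb : b ≠ 0) : ord v (a / b) = ord v a - ord v b := by
  rw [eq_sub_iff_add_eq, ← ord_mul v (div_ne_zero ha hb) hb, div_mul_cancel₀ _ hb]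

theorem mem_valRing_iff {a : K} (ha : a ≠ 0) : a ∈ valRing v ↔ 0 ≤ ord v a := by
  rw [mem_valRing, ← coe_ord v ha, ← WithTop.coe_zero, WithTop.coe_le_coe]
  rfl

theorem residue_eq_zero_iff {a : valRing v} (ha : (a : K) ≠ 0) :
    IsLocalRing.residue (valRing v) a = 0 ↔ 0 < ord v (a : K) := by
  have ha' : 0 ≤ ord v (a : K) := (mem_valRing_iff v ha).1 a.2
  rw [IsLocalRing.residue_eq_zero_iff, IsLocalRing.mem_maximalIdeal, mem_nonunits_iff]
  have key : IsUnit a ↔ ord v (a : K) ≤ 0 := by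
    constructor
    · intro h
      obtain ⟨b, hb⟩ := h.exists_right_inv
      have hb' : (a : K) * b = 1 := congrArg Subtype.val hb
      have hb0 : (b : K) ≠ 0 := right_ne_zero_of_mul_eq_one hb'
      have h1 := ord_mul v ha hb0
      rw [hb', ord_eq_of_coe v (γ := 0) (by simp)] at h1
      have h2 : 0 ≤ ord v (b : K) := (mem_valRing_iff v hb0).1 b.2
      rw [eq_comm, add_eq_zero_iff_eq_neg] at h1
      rw [h1]
      exact neg_nonpos.2 h2
    · intro h
      have hinv : (a : K)⁻¹ ∈ valRing v := by
        rw [mem_valRing_iff v (inv_ne_zero ha), ← one_div, ord_div v one_ne_zero ha,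
          ord_eq_of_coe v (γ := 0) (by simp), zero_sub]
        exact neg_nonneg.2 h
      exact IsUnit.of_mul_eq_one ⟨_, hinv⟩ (Subtype.ext (mul_inv_cancel₀ ha))
  rw [key, not_le]

variable (φ : Multiplicative (valueGroup v) →* Kˣ)

/-- The element `t ^ γ` of the splitting. -/
def tpow (γ : valueGroup v) : K := (φ (Multiplicative.ofAdd γ) : K)

theorem tpow_ne_zero (γ : valueGroup v) : tpow v φ γ ≠ 0 := Units.ne_zero _

@[simp]
theorem tpow_zero : tpow v φ 0 = 1 := by simp [tpow]

theorem tpow_add (γ δ : valueGroup v) : tpow v φ (γ + δ) = tpow v φ γ * tpow v φ δ := by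
  simp [tpow]

theorem tpow_mul_neg (γ : valueGroup v) : tpow v φ γ * tpow v φ (-γ) = 1 := by
  rw [← tpow_add, add_neg_cancel, tpow_zero]

theorem tpow_neg_mul (γ : valueGroup v) : tpow v φ (-γ) * tpow v φ γ = 1 := by
  rw [← tpow_add, neg_add_cancel, tpow_zero]

theorem tpow_sum {α : Type*} (s : Finset α) (γ : α → valueGroup v) :
    tpow v φ (∑ i ∈ s, γ i) = ∏ i ∈ s, tpow v φ (γ i) := by
  classical
  induction s using Finset.induction_on with
  | empty => simp
  | insert a s ha ih => rw [Finset.sum_insert ha, Finset.prod_insert ha, tpow_add, ih]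

variable {φ} in
theorem ord_tpow (hφ : IsSplitting v φ) (γ : valueGroup v) : ord v (tpow v φ γ) = γ :=
  ord_eq_of_coe v (hφ γ)

/-! ### Initial spaces of linear subspaces -/

variable {ι : Type*}

/-- The initial space of a linear subspace with respect to a weight on the coordinates: rescale the
coordinates by `t ^ ω`, and reduce the vectors with entries in the valuation ring. -/
def initialSpace (V : Submodule K (ι → K)) (ω : ι → valueGroup v) :
    Submodule (ResField v) (ι → ResField v) where
  carrier := {g | ∃ p : ι → valRing v, (fun u => tpow v φ (-ω u) * (p u : K)) ∈ V ∧
    ∀ u, IsLocalRing.residue (valRing v) (p u) = g u}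
  zero_mem' := by
    refine ⟨0, ?_, fun u => by simp⟩
    convert V.zero_mem using 1
    funext u
    simp
  add_mem' := by
    rintro g g' ⟨p, hp, hg⟩ ⟨p', hp', hg'⟩
    refine ⟨p + p', ?_, fun u => by simp [hg, hg']⟩
    convert V.add_mem hp hp' using 1
    funext u
    simp [mul_add]
  smul_mem' := by
    rintro a g ⟨p, hp, hg⟩
    obtain ⟨r, rfl⟩ := IsLocalRing.residue_surjective a
    refine ⟨r • p, ?_, fun u => by simp [hg]⟩
    convert V.smul_mem (r : K) hp using 1
    funext u
    simp [mul_left_comm]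

variable {v φ}

theorem sum_update (ω : ι → valueGroup v) {r : ℕ} (J : Fin r → ι) (i : Fin r) (u : ι) :
    ∑ j, ω (Function.update J i u j) = (ω u - ω (J i)) + ∑ j, ω (J j) := by
  have h : (fun j => ω (Function.update J i u j)) = Function.update (fun j => ω (J j)) i (ω u) := by
    funext j
    by_cases e : j = i
    · subst e; simp
    · simp [Function.update_of_ne e]
  rw [h, Finset.sum_update_of_mem (Finset.mem_univ i),
    ← Finset.add_sum_erase _ _ (Finset.mem_univ i), Finset.sdiff_singleton_eq_erase]
  abel

variable [Finite ι] (V : Submodule K (ι → K))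

/-- The column sets of the nonzero Plücker coordinates. -/
abbrev PluckerIndex : Type _ := {J : Fin (finrank K V) → ι // plucker V J ≠ 0}

instance : Nonempty (PluckerIndex V) :=
  let ⟨J, hJ⟩ := exists_plucker_ne_zero V
  ⟨⟨J, hJ⟩⟩

variable (v) in
/-- The term with index `J` of the tropical polynomial of the Plücker coordinates of `V`. -/
noncomputable def pluckerWeight (ω : ι → valueGroup v) (J : PluckerIndex V) : valueGroup v :=
  ord v (plucker V J) + ∑ j, ω (J.1 j)

variable (v) in
/-- The indices of the terms of minimal weight. -/
def pluckerMin (ω : ι → valueGroup v) : Set (PluckerIndex V) :=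
  {J | ∀ J', pluckerWeight v V ω J ≤ pluckerWeight v V ω J'}

theorem pluckerMin_nonempty (ω : ι → valueGroup v) : (pluckerMin v V ω).Nonempty :=
  Finite.exists_min (pluckerWeight v V ω)

variable {V}

variable (v φ) in
/-- The rescaled echelon matrix. -/
noncomputable def scaledEchelon (ω : ι → valueGroup v) (J : Fin (finrank K V) → ι)
    (i : Fin (finrank K V)) (u : ι) : K :=
  tpow v φ (ω u - ω (J i)) * echelon J i u

/-! ### The initial space as the row space of a reduced echelon matrix -/

section

variable (hφ : IsSplitting v φ) {ω : ι → valueGroup v} {J : PluckerIndex V}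
include hφ

theorem ord_scaledEchelon (ω : ι → valueGroup v) (J : PluckerIndex V) {i : Fin (finrank K V)}
    {u : ι} (h : plucker V (Function.update J.1 i u) ≠ 0) :
    ord v (scaledEchelon v φ ω J.1 i u) =
      pluckerWeight v V ω ⟨_, h⟩ - pluckerWeight v V ω J := by
  rw [scaledEchelon, echelon, ord_mul v (tpow_ne_zero _ _ _) (div_ne_zero h J.2), ord_tpow v hφ,
    ord_div v h J.2, pluckerWeight, pluckerWeight, sum_update]
  abel

theorem scaledEchelon_mem (hJ : J ∈ pluckerMin v V ω) (i : Fin (finrank K V)) (u : ι) :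
    scaledEchelon v φ ω J.1 i u ∈ valRing v := by
  by_cases h : plucker V (Function.update J.1 i u) = 0
  · rw [scaledEchelon, echelon, h, zero_div, mul_zero]
    exact zero_mem _
  · have h0 : scaledEchelon v φ ω J.1 i u ≠ 0 :=
      mul_ne_zero (tpow_ne_zero _ _ _) (div_ne_zero h J.2)
    rw [mem_valRing_iff v h0,
      ord_scaledEchelon hφ ω J h, sub_nonneg]
    exact hJ _

/-- The rescaled echelon matrix, with entries in the valuation ring. -/
noncomputable def integralEchelon (hJ : J ∈ pluckerMin v V ω) :
    Matrix (Fin (finrank K V)) ι (valRing v) :=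
  Matrix.of fun i u => ⟨scaledEchelon v φ ω J.1 i u, scaledEchelon_mem hφ hJ i u⟩

/-- The reduction of the rescaled echelon matrix. -/
noncomputable def reducedEchelon (hJ : J ∈ pluckerMin v V ω) :
    Matrix (Fin (finrank K V)) ι (ResField v) :=
  (integralEchelon hφ hJ).map (IsLocalRing.residue (valRing v))

theorem reducedEchelon_pivot (hJ : J ∈ pluckerMin v V ω) (i j : Fin (finrank K V)) :
    reducedEchelon hφ hJ i (J.1 j) = (1 : Matrix _ _ (ResField v)) i j := by
  have h : integralEchelon hφ hJ i (J.1 j) = (1 : Matrix _ _ (valRing v)) i j := by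
    apply Subtype.ext
    change scaledEchelon v φ ω J.1 i (J.1 j) = _
    rw [scaledEchelon, echelon_pivot J.2]
    by_cases e : i = j
    · subst e; simp
    · simp [Matrix.one_apply_ne e]
  rw [reducedEchelon, Matrix.map_apply, h]
  by_cases e : i = j
  · subst e; simp
  · simp [Matrix.one_apply_ne e]

/-- An integral vector of the rescaled space is the combination of the echelon rows whose
coefficients are its own entries at the pivots. These are integral, so the identity survives
reduction; conversely, coefficients lift. -/
theorem mem_initialSpace_iff (hJ : J ∈ pluckerMin v V ω) {g : ι → ResField v} :
    g ∈ initialSpace v φ V ω ↔ ∃ y, Matrix.vecMul y (reducedEchelon hφ hJ) = g := by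
  constructor
  · rintro ⟨p, hp, hg⟩
    refine ⟨fun j => IsLocalRing.residue _ (p (J.1 j)), ?_⟩
    funext u
    have h : p u = ∑ j, p (J.1 j) * integralEchelon hφ hJ j u := by
      apply Subtype.ext
      have e := congrArg (fun x => tpow v φ (ω u) * x) (eq_sum_echelon J.2 hp u)
      simp only [← mul_assoc, tpow_mul_neg, one_mul] at e
      rw [e]
      push_cast
      rw [Finset.mul_sum]
      refine Finset.sum_congr rfl fun j _ => ?_
      change _ = (p (J.1 j) : K) * (tpow v φ (ω u - ω (J.1 j)) * echelon J.1 j u)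
      rw [sub_eq_add_neg, tpow_add]
      ring
    rw [← hg, h, map_sum]
    simp [Matrix.vecMul, dotProduct, reducedEchelon]
  · rintro ⟨y, rfl⟩
    choose z hz using fun j => IsLocalRing.residue_surjective (y j)
    refine ⟨fun u => ∑ j, z j * integralEchelon hφ hJ j u, ?_, fun u => ?_⟩
    · have : (fun u => tpow v φ (-ω u) *
          ((∑ j, z j * integralEchelon hφ hJ j u : valRing v) : K)) =
          ∑ j, ((z j : K) * tpow v φ (-ω (J.1 j))) • echelon J.1 j := by
        funext u
        push_cast
        rw [Finset.mul_sum, Finset.sum_apply]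
        refine Finset.sum_congr rfl fun j _ => ?_
        change _ * ((z j : K) * (tpow v φ (ω u - ω (J.1 j)) * echelon J.1 j u)) = _
        rw [sub_eq_add_neg, tpow_add, Pi.smul_apply, smul_eq_mul]
        linear_combination ((z j : K) * tpow v φ (-ω (J.1 j)) * echelon J.1 j u) *
          tpow_neg_mul v φ (ω u)
      rw [this]
      exact V.sum_mem fun j _ => V.smul_mem _ (echelon_mem J.2 j)
    · simp [map_sum, Matrix.vecMul, dotProduct, reducedEchelon, hz]

theorem finrank_initialSpace (V : Submodule K (ι → K)) (ω : ι → valueGroup v) :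
    finrank (ResField v) (initialSpace v φ V ω) = finrank K V := by
  obtain ⟨J, hJ⟩ := pluckerMin_nonempty V ω
  let f := (reducedEchelon hφ hJ).vecMulLinear
  have hrange : initialSpace v φ V ω = LinearMap.range f := by
    ext g
    exact mem_initialSpace_iff hφ hJ
  have hinj : Function.Injective f := by
    intro y y' h
    have e : ∀ z : Fin (finrank K V) → ResField v, ∀ i, f z (J.1 i) = z i := by
      intro z i
      simp [f, Matrix.vecMul, dotProduct, reducedEchelon_pivot hφ hJ, Matrix.one_apply]
    funext i
    rw [← e y, ← e y', h]
  rw [hrange, LinearMap.finrank_range_of_inj hinj, finrank_fin_fun]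

/-- The minor of the integral echelon matrix at `J'` has valuation equal to the weight of `J'` minus
that of `J`. A nonzero residue makes this nonpositive. -/
theorem mem_pluckerMin_of_det_ne_zero (hJ : J ∈ pluckerMin v V ω) {J' : PluckerIndex V}
    (h : (Matrix.of fun i j => reducedEchelon hφ hJ i (J'.1 j)).det ≠ 0) :
    J' ∈ pluckerMin v V ω := by
  set M : Matrix (Fin (finrank K V)) (Fin (finrank K V)) (valRing v) :=
    Matrix.of fun i j => integralEchelon hφ hJ i (J'.1 j) with hM
  have h1 : IsLocalRing.residue (valRing v) M.det ≠ 0 := by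
    rw [RingHom.map_det]
    exact h
  have h2 : (M.det : K) = tpow v φ (∑ j, ω (J'.1 j) - ∑ j, ω (J.1 j)) *
      (plucker V J'.1 / plucker V J.1) := by
    have e : (M.det : K) = (Matrix.of fun i j => tpow v φ (-ω (J.1 i)) *
        (Matrix.of fun i j => tpow v φ (ω (J'.1 j)) *
          (Matrix.of fun i j => echelon J.1 i (J'.1 j)) i j) i j).det := by
      change (valRing v).subtype M.det = _
      rw [RingHom.map_det]
      congr 1
      ext i j
      change tpow v φ (ω (J'.1 j) - ω (J.1 i)) * echelon J.1 i (J'.1 j) =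
        tpow v φ (-ω (J.1 i)) * (tpow v φ (ω (J'.1 j)) * echelon J.1 i (J'.1 j))
      rw [sub_eq_add_neg, tpow_add]
      ring
    rw [e, Matrix.det_mul_column, Matrix.det_mul_row, plucker_eq_mul_det J.2 J'.1,
      mul_div_cancel_left₀ _ J.2, sub_eq_add_neg, tpow_add, ← Finset.sum_neg_distrib, tpow_sum,
      tpow_sum]
    ring
  have h0 : (M.det : K) ≠ 0 := by
    rw [h2]
    exact mul_ne_zero (tpow_ne_zero _ _ _) (div_ne_zero J'.2 J.2)
  rw [Ne, residue_eq_zero_iff v h0, h2,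
    ord_mul v (tpow_ne_zero _ _ _) (div_ne_zero J'.2 J.2), ord_tpow v hφ, ord_div v J'.2 J.2] at h1
  have h3 : pluckerWeight v V ω J' ≤ pluckerWeight v V ω J := by
    rw [← sub_nonpos, pluckerWeight, pluckerWeight]
    have e : ord v (plucker V J'.1) + ∑ j, ω (J'.1 j) - (ord v (plucker V J.1) + ∑ j, ω (J.1 j)) =
        ∑ j, ω (J'.1 j) - ∑ j, ω (J.1 j) + (ord v (plucker V J'.1) - ord v (plucker V J.1)) := by
      abel
    rw [e]
    exact not_lt.1 h1
  exact fun J'' => h3.trans (hJ J'')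

/-- The reduced matrix for `ω'` is a multiple `P` of the one for `ω` and has an identity block at
`J'`, so the minor at `J'` of the latter is invertible. -/
theorem pluckerMin_subset_of_initialSpace_le {ω ω' : ι → valueGroup v}
    (h : initialSpace v φ V ω' ≤ initialSpace v φ V ω) :
    pluckerMin v V ω' ⊆ pluckerMin v V ω := by
  intro J' hJ'
  obtain ⟨J, hJ⟩ := pluckerMin_nonempty V ω
  have hrow : ∀ i, ∃ y, Matrix.vecMul y (reducedEchelon hφ hJ) = reducedEchelon hφ hJ' i := by
    intro i
    refine (mem_initialSpace_iff hφ hJ).1 (h ((mem_initialSpace_iff hφ hJ').2 ⟨Pi.single i 1, ?_⟩))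
    simp
    rfl
  choose P hP using hrow
  refine mem_pluckerMin_of_det_ne_zero hφ hJ fun hdet => ?_
  have hmul : Matrix.of P * (Matrix.of fun i j => reducedEchelon hφ hJ i (J'.1 j)) = 1 := by
    ext i j
    rw [← reducedEchelon_pivot hφ hJ' i j, ← hP i]
    rfl
  have := congrArg Matrix.det hmul
  rw [Matrix.det_mul, hdet, mul_zero, Matrix.det_one] at this
  exact zero_ne_one this

theorem initialSpace_eq_of_pluckerMin_eq {ω ω' : ι → valueGroup v}
    (h : pluckerMin v V ω = pluckerMin v V ω') :
    initialSpace v φ V ω = initialSpace v φ V ω' := by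
  obtain ⟨J, hJ⟩ := pluckerMin_nonempty V ω
  have hJ' : J ∈ pluckerMin v V ω' := h ▸ hJ
  have hN : reducedEchelon hφ hJ = reducedEchelon hφ hJ' := by
    ext i u
    by_cases h0 : plucker V (Function.update J.1 i u) = 0
    · have : ∀ ω'' : ι → valueGroup v, scaledEchelon v φ ω'' J.1 i u = 0 := fun ω'' => by
        rw [scaledEchelon, echelon, h0, zero_div, mul_zero]
      simp only [reducedEchelon, integralEchelon, Matrix.map_apply, Matrix.of_apply, this]
    have hne : ∀ ω'' : ι → valueGroup v, scaledEchelon v φ ω'' J.1 i u ≠ 0 := fun ω'' =>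
      mul_ne_zero (tpow_ne_zero _ _ _) (div_ne_zero h0 J.2)
    by_cases h1 : (⟨_, h0⟩ : PluckerIndex V) ∈ pluckerMin v V ω
    -- A tie between `J` and the exchanged index fixes the exponent of `t` in terms of the Plücker
    -- coordinates alone. Without a tie, the entry has positive valuation and reduces to zero.
    · have e : ∀ ω'' : ι → valueGroup v, J ∈ pluckerMin v V ω'' →
          (⟨_, h0⟩ : PluckerIndex V) ∈ pluckerMin v V ω'' → ω'' u - ω'' (J.1 i) =
            ord v (plucker V J.1) - ord v (plucker V (Function.update J.1 i u)) := by
        intro ω'' hJ hJ'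
        have := le_antisymm (hJ' J) (hJ ⟨_, h0⟩)
        rw [pluckerWeight, pluckerWeight, sum_update, ← add_assoc, add_left_inj] at this
        rw [← this]
        abel
      simp only [reducedEchelon, integralEchelon, Matrix.map_apply, Matrix.of_apply,
        scaledEchelon, e ω hJ h1, e ω' hJ' (h ▸ h1)]
    · have e : ∀ ω'' : ι → valueGroup v, ∀ hJ : J ∈ pluckerMin v V ω'',
          (⟨_, h0⟩ : PluckerIndex V) ∉ pluckerMin v V ω'' →
          reducedEchelon hφ hJ i u = 0 := by
        intro ω'' hJ hJ'
        refine (residue_eq_zero_iff v (hne ω'')).2 ?_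
        change 0 < ord v (scaledEchelon v φ ω'' J.1 i u)
        rw [ord_scaledEchelon hφ ω'' J h0, sub_pos]
        by_contra hlt
        exact hJ' fun J'' => (not_lt.1 hlt).trans (hJ J'')
      rw [e ω hJ h1, e ω' hJ' (h ▸ h1)]
  ext g
  rw [mem_initialSpace_iff hφ hJ, mem_initialSpace_iff hφ hJ', hN]

theorem initialSpace_eq_iff {ω ω' : ι → valueGroup v} :
    initialSpace v φ V ω = initialSpace v φ V ω' ↔ pluckerMin v V ω = pluckerMin v V ω' :=
  ⟨fun h => subset_antisymm (pluckerMin_subset_of_initialSpace_le hφ h.le)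
    (pluckerMin_subset_of_initialSpace_le hφ h.ge), initialSpace_eq_of_pluckerMin_eq hφ⟩

theorem finite_range_initialSpace (V : Submodule K (ι → K)) :
    (Set.range (initialSpace v φ V)).Finite := by
  refine (Set.finite_range fun A : Set (PluckerIndex V) =>
    initialSpace v φ V (Function.invFun (pluckerMin v V) A)).subset ?_
  rintro _ ⟨ω, rfl⟩
  exact ⟨pluckerMin v V ω, initialSpace_eq_of_pluckerMin_eq hφ
    (Function.invFun_eq (f := pluckerMin v V) ⟨ω, rfl⟩)⟩

end

end Valued

end GrobnerComplex

namespace GrobnerComplex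

open Module MvPolynomial

/-! ### Truncation of ideals by degree -/

section Truncation

variable {n : ℕ}

/-- The exponents of degree at most `d`. -/
abbrev Exponent (n d : ℕ) : Type := {u : Fin (n + 1) →₀ ℕ // u.degree ≤ d}

instance (n d : ℕ) : Finite (Exponent n d) := (Finsupp.finite_of_degree_le d).to_subtype

theorem exists_coeff_eq {A : Type*} [CommSemiring A] {d : ℕ} (c : Exponent n d → A) :
    ∃ f : MvPolynomial (Fin (n + 1)) A, (∀ u, d < u.degree → coeff u f = 0) ∧
      ∀ u : Exponent n d, coeff u f = c u := by
  classical
  have := Fintype.ofFinite (Exponent n d)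
  refine ⟨∑ u, monomial u.1 (c u), fun u hu => ?_, fun u => ?_⟩
  · rw [coeff_sum]
    refine Finset.sum_eq_zero fun u' _ => ?_
    rw [coeff_monomial, if_neg]
    rintro rfl
    exact hu.not_ge u'.2
  · rw [coeff_sum, Finset.sum_eq_single u]
    · rw [coeff_monomial, if_pos rfl]
    · intro u' _ h
      rw [coeff_monomial, if_neg fun e => h (Subtype.ext e)]
    · simp

theorem coeff_eq_zero_of_totalDegree_lt_degree {A : Type*} [CommSemiring A]
    {f : MvPolynomial (Fin (n + 1)) A} {u : Fin (n + 1) →₀ ℕ} (h : f.totalDegree < u.degree) :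
    coeff u f = 0 := by
  refine coeff_eq_zero_of_totalDegree_lt (lt_of_lt_of_eq h ?_)
  rfl

variable {F : Type*} [Field F]

/-- The coefficient vectors of the elements of degree at most `d` of an ideal. -/
def trunc (d : ℕ) (I : Ideal (MvPolynomial (Fin (n + 1)) F)) : Submodule F (Exponent n d → F) where
  carrier := {c | ∃ f ∈ I, (∀ u, d < u.degree → coeff u f = 0) ∧
    ∀ u : Exponent n d, coeff u f = c u}
  zero_mem' := ⟨0, I.zero_mem, by simp, by simp⟩
  add_mem' := by
    rintro c c' ⟨f, hf, h, e⟩ ⟨f', hf', h', e'⟩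
    refine ⟨f + f', I.add_mem hf hf', fun u hu => ?_, fun u => ?_⟩
    · rw [coeff_add, h u hu, h' u hu, add_zero]
    · rw [coeff_add, e, e', Pi.add_apply]
  smul_mem' := by
    rintro a c ⟨f, hf, h, e⟩
    refine ⟨C a * f, I.mul_mem_left _ hf, fun u hu => ?_, fun u => ?_⟩
    · rw [coeff_C_mul, h u hu, mul_zero]
    · rw [coeff_C_mul, e, Pi.smul_apply, smul_eq_mul]

theorem mem_trunc_iff {d : ℕ} {I : Ideal (MvPolynomial (Fin (n + 1)) F)}
    {f : MvPolynomial (Fin (n + 1)) F} (hf : ∀ u, d < u.degree → coeff u f = 0) :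
    (fun u : Exponent n d => coeff u.1 f) ∈ trunc d I ↔ f ∈ I := by
  refine ⟨?_, fun h => ⟨f, h, hf, fun _ => rfl⟩⟩
  rintro ⟨g, hg, hg', e⟩
  have : f = g := by
    ext u
    by_cases hu : u.degree ≤ d
    · exact (e ⟨u, hu⟩).symm
    · rw [hf u (not_le.1 hu), hg' u (not_le.1 hu)]
  exact this ▸ hg

theorem trunc_le_iff {d : ℕ} {I I' : Ideal (MvPolynomial (Fin (n + 1)) F)} :
    trunc d I ≤ trunc d I' ↔ ∀ f ∈ I, (∀ u, d < u.degree → coeff u f = 0) → f ∈ I' := by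
  constructor
  · exact fun h f hf hd => (mem_trunc_iff hd).1 (h ((mem_trunc_iff hd).2 hf))
  · rintro h c ⟨f, hf, hd, e⟩
    exact ⟨f, h f hf hd, hd, e⟩

theorem trunc_mono {d : ℕ} {I I' : Ideal (MvPolynomial (Fin (n + 1)) F)} (h : I ≤ I') :
    trunc d I ≤ trunc d I' :=
  trunc_le_iff.2 fun _ hf _ => h hf

theorem trunc_eq_of_le {d e : ℕ} (hde : d ≤ e) {I I' : Ideal (MvPolynomial (Fin (n + 1)) F)}
    (h : trunc e I = trunc e I') : trunc d I = trunc d I' :=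
  le_antisymm
    (trunc_le_iff.2 fun f hf hd => trunc_le_iff.1 h.le f hf fun u hu => hd u (hde.trans_lt hu))
    (trunc_le_iff.2 fun f hf hd => trunc_le_iff.1 h.ge f hf fun u hu => hd u (hde.trans_lt hu))

theorem eq_of_le_of_finrank_trunc_eq {I I' : Ideal (MvPolynomial (Fin (n + 1)) F)} (h : I ≤ I')
    (hr : ∀ d, finrank F (trunc d I) = finrank F (trunc d I')) : I = I' := by
  refine le_antisymm h fun f hf => ?_
  have := Submodule.eq_of_le_of_finrank_eq (trunc_mono (d := f.totalDegree) h) (hr _)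
  exact trunc_le_iff.1 this.ge f hf fun u hu => coeff_eq_zero_of_totalDegree_lt_degree hu

/-- Any bound on the degrees of a finite generating set will do. -/
theorem exists_trunc_le_imp_le (I : Ideal (MvPolynomial (Fin (n + 1)) F)) :
    ∃ d, ∀ I', trunc d I ≤ trunc d I' → I ≤ I' := by
  obtain ⟨S, hS⟩ := IsNoetherian.noetherian I
  refine ⟨S.sup totalDegree, fun I' h => ?_⟩
  rw [← hS]
  refine Submodule.span_le.2 fun f hf => ?_
  refine trunc_le_iff.1 h f (hS ▸ Submodule.subset_span hf) fun u hu => ?_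
  exact coeff_eq_zero_of_totalDegree_lt_degree ((Finset.le_sup (f := totalDegree) hf).trans_lt hu)

/-- In a family of ideals with the same Hilbert function, and with finitely many truncations in
each degree, the members are determined by their truncations in a suitable degree. -/
theorem exists_trunc_determines {X : Type*} (L : X → Ideal (MvPolynomial (Fin (n + 1)) F))
    (hfin : ∀ d, (Set.range fun x => trunc d (L x)).Finite)
    (hrank : ∀ d x y, finrank F (trunc d (L x)) = finrank F (trunc d (L y))) :
    ∃ d, ∀ x y, trunc d (L x) = trunc d (L y) → L x = L y := by
  by_contra! hcon
  choose x y heq hne using hcon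
  -- `x d` and `y d` form a counterexample for degree `d`; `J` is the limit of the ideals `L (x d)`
  -- along a nonprincipal ultrafilter.
  let U := Filter.hyperfilter ℕ
  let J : Ideal (MvPolynomial (Fin (n + 1)) F) :=
    { carrier := {g | ∀ᶠ d in (U : Filter ℕ), g ∈ L (x d)}
      zero_mem' := Filter.Eventually.of_forall fun d => (L (x d)).zero_mem
      add_mem' := fun hf hg => by
        filter_upwards [hf, hg] with d h h' using (L (x d)).add_mem h h'
      smul_mem' := fun c g hg => by
        filter_upwards [hg] with d h using (L (x d)).mul_mem_left c h }
  have hJ : ∀ e, ∀ᶠ d in (U : Filter ℕ), trunc e (L (x d)) = trunc e J := by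
    intro e
    -- Among finitely many possible truncations, the ultrafilter selects one.
    obtain ⟨W, -, hW⟩ := (Ultrafilter.eventually_exists_mem_iff (f := U)
      (P := fun W d => trunc e (L (x d)) = W) (hfin e)).1
        (Filter.Eventually.of_forall fun d => ⟨_, ⟨x d, rfl⟩, rfl⟩)
    have hWJ : W = trunc e J := by
      ext c
      constructor
      · intro hc
        obtain ⟨f, hf, hfc⟩ := exists_coeff_eq c
        refine ⟨f, ?_, hf, hfc⟩
        change ∀ᶠ d in (U : Filter ℕ), f ∈ L (x d)
        filter_upwards [hW] with d hd
        rw [← mem_trunc_iff hf, hd]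
        convert hc using 1
        exact funext hfc
      · rintro ⟨f, hf, hfd, hfc⟩
        obtain ⟨d, hd, hd'⟩ := (hW.and hf).exists
        rw [← hd]
        exact ⟨f, hd', hfd, hfc⟩
    exact hWJ ▸ hW
  have hrankJ : ∀ z e, finrank F (trunc e J) = finrank F (trunc e (L z)) := by
    intro z e
    obtain ⟨d, hd⟩ := (hJ e).exists
    rw [← hd, hrank e (x d) z]
  obtain ⟨e, he⟩ := exists_trunc_le_imp_le J
  obtain ⟨d, hd, hde⟩ := ((hJ e).and (Nat.hyperfilter_le_atTop
    (Filter.eventually_ge_atTop e))).exists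
  -- As `d ≥ e`, both `L (x d)` and `L (y d)` contain generators of `J`, and equal Hilbert functions
  -- turn the inclusions into equalities.
  have h1 : J = L (x d) := eq_of_le_of_finrank_trunc_eq (he _ hd.ge) (hrankJ _)
  have h2 : J = L (y d) := eq_of_le_of_finrank_trunc_eq
    (he _ (hd.symm.trans (trunc_eq_of_le hde (heq d))).le) (hrankJ _)
  exact hne d (h1.symm.trans h2)

end Truncation

/-! ### Initial ideals -/

section InitialIdeal

variable {K : Type*} [Field K] {v : AddValuation K (WithTop ℝ)}
  {φ : Multiplicative (valueGroup v) →* Kˣ} {n : ℕ}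

variable (φ) in
/-- The substitution `x_i ↦ t ^ (-w_i) x_i` on polynomials over the valuation ring. -/
noncomputable def rescale (w : Fin (n + 1) → valueGroup v) :
    MvPolynomial (Fin (n + 1)) (valRing v) →+* MvPolynomial (Fin (n + 1)) K :=
  eval₂Hom (C.comp (valRing v).subtype) fun i => C (tpow v φ (-w i)) * X i

theorem tpow_neg_dot (w : Fin (n + 1) → valueGroup v) (u : Fin (n + 1) →₀ ℕ) :
    tpow v φ (-dot v w u) = ∏ i, tpow v φ (-w i) ^ u i := by
  rw [dot, ← Finset.sum_neg_distrib, tpow_sum]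
  refine Finset.prod_congr rfl fun i _ => ?_
  rw [← smul_neg]
  induction u i with
  | zero => simp
  | succ k ih => rw [succ_nsmul, tpow_add, ih, pow_succ]

theorem rescale_monomial (w : Fin (n + 1) → valueGroup v) (u : Fin (n + 1) →₀ ℕ)
    (a : valRing v) :
    rescale φ w (monomial u a) = monomial u (tpow v φ (-dot v w u) * (a : K)) := by
  rw [rescale, coe_eval₂Hom, eval₂_monomial, tpow_neg_dot, monomial_eq (s := u) (a := _ * _),
    Finsupp.prod_fintype _ _ (by simp), Finsupp.prod_fintype _ _ (by simp)]
  simp only [mul_pow, Finset.prod_mul_distrib, map_mul, map_prod, map_pow]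
  change C (a : K) * _ = _
  ring

theorem coeff_rescale (w : Fin (n + 1) → valueGroup v) (u : Fin (n + 1) →₀ ℕ)
    (p : MvPolynomial (Fin (n + 1)) (valRing v)) :
    coeff u (rescale φ w p) = tpow v φ (-dot v w u) * ((coeff u p : valRing v) : K) := by
  induction p using MvPolynomial.induction_on' with
  | monomial s a =>
    classical
    rw [rescale_monomial, coeff_monomial, coeff_monomial]
    split_ifs with h
    · rw [h]
    · simp
  | add p q hp hq => rw [map_add, coeff_add, coeff_add, hp, hq]; push_cast; ring

theorem residue_coe (a : valRing v) : residue v (a : K) = IsLocalRing.residue (valRing v) a := by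
  rw [residue, dif_pos a.2]

theorem coeff_initialForm (w : Fin (n + 1) → valueGroup v) (f : MvPolynomial (Fin (n + 1)) K)
    (u : Fin (n + 1) →₀ ℕ) :
    coeff u (initialForm v φ w f) = residue v (tpow v φ (dot v w u - trop v f w) * coeff u f) := by
  classical
  rw [initialForm, coeff_sum]
  simp only [coeff_monomial, Finset.sum_ite_eq']
  split_ifs with h
  · rfl
  · rw [notMem_support_iff.1 h, mul_zero, residue, dif_pos (zero_mem _)]
    exact (map_zero (IsLocalRing.residue (valRing v))).symm

/-- A polynomial whose rescaled coefficients are integral with a nonzero residue has the reduction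
of the rescaled polynomial as its initial form. -/
theorem initialForm_rescale (hφ : IsSplitting v φ) (w : Fin (n + 1) → valueGroup v)
    (p : MvPolynomial (Fin (n + 1)) (valRing v))
    (hp : map (IsLocalRing.residue (valRing v)) p ≠ 0) :
    initialForm v φ w (rescale φ w p) = map (IsLocalRing.residue (valRing v)) p := by
  obtain ⟨u₀, hu₀⟩ := ne_zero_iff.1 hp
  rw [coeff_map] at hu₀
  have hne : ∀ u, coeff u (rescale φ w p) ≠ 0 ↔ ((coeff u p : valRing v) : K) ≠ 0 := fun u => by
    rw [coeff_rescale, mul_ne_zero_iff, and_iff_right (tpow_ne_zero _ _ _)]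
  have hu₀' : ((coeff u₀ p : valRing v) : K) ≠ 0 := fun h => hu₀ (by
    rw [show coeff u₀ p = 0 from Subtype.ext h, map_zero])
  have hord : ∀ u, ((coeff u p : valRing v) : K) ≠ 0 →
      ord v (coeff u (rescale φ w p)) + dot v w u = ord v ((coeff u p : valRing v) : K) := by
    intro u hu
    rw [coeff_rescale, ord_mul v (tpow_ne_zero _ _ _) hu, ord_tpow v hφ]
    abel
  have htrop : trop v (rescale φ w p) w = 0 := by
    have hmem : u₀ ∈ (rescale φ w p).support := mem_support_iff.2 ((hne u₀).2 hu₀')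
    rw [trop, dif_pos ⟨u₀, hmem⟩]
    refine le_antisymm ((Finset.inf'_le _ hmem).trans ?_) (Finset.le_inf' _ _ fun u hu => ?_)
    · rw [hord u₀ hu₀']
      exact not_lt.1 fun h => hu₀ ((residue_eq_zero_iff v hu₀').2 h)
    · have hu' := (hne u).1 (mem_support_iff.1 hu)
      rw [hord u hu']
      exact (mem_valRing_iff v hu').1 (coeff u p).2
  ext u
  rw [coeff_initialForm, htrop, sub_zero, coeff_rescale, ← mul_assoc, tpow_mul_neg, one_mul,
    residue_coe, coeff_map]

/-- Multiplying `f` by `t ^ (-W)` makes its rescaled coefficients integral, so initial forms are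
reductions. As reduction is surjective, every element of the initial ideal, not only a generator, is
then the reduction of a single polynomial. -/
theorem initialIdeal_eq (hφ : IsSplitting v φ) (w : Fin (n + 1) → valueGroup v)
    (I : Ideal (MvPolynomial (Fin (n + 1)) K)) :
    initialIdeal v φ w I =
      (I.comap (rescale φ w)).map (map (IsLocalRing.residue (valRing v))) := by
  refine le_antisymm (Ideal.span_le.2 ?_) (Ideal.map_le_iff_le_comap.2 fun p hp => ?_)
  · rintro _ ⟨f, hf, rfl⟩
    classical
    let c : (Fin (n + 1) →₀ ℕ) → valRing v := fun u =>
      if h : tpow v φ (dot v w u - trop v f w) * coeff u f ∈ valRing v then ⟨_, h⟩ else 0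
    have hc : ∀ u, (c u : K) = tpow v φ (dot v w u - trop v f w) * coeff u f := by
      intro u
      have h : tpow v φ (dot v w u - trop v f w) * coeff u f ∈ valRing v := by
        by_cases hu : u ∈ f.support
        · exact initialForm_coeff_mem v φ hφ w f u hu
        · rw [notMem_support_iff.1 hu, mul_zero]
          exact zero_mem _
      simp only [c, dif_pos h]
    let p : MvPolynomial (Fin (n + 1)) (valRing v) := ∑ u ∈ f.support, monomial u (c u)
    have hp : ∀ u, coeff u p = c u := by
      intro u
      simp only [p, coeff_sum, coeff_monomial, Finset.sum_ite_eq']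
      split_ifs with h
      · rfl
      · refine Subtype.ext ?_
        rw [hc, notMem_support_iff.1 h, mul_zero]
        rfl
    have h1 : rescale φ w p = C (tpow v φ (-trop v f w)) * f := by
      ext u
      rw [coeff_rescale, hp, hc, coeff_C_mul, ← mul_assoc, ← tpow_add]
      congr 2
      abel
    have h2 : map (IsLocalRing.residue (valRing v)) p = initialForm v φ w f := by
      ext u
      rw [coeff_map, coeff_initialForm, hp, ← hc, residue_coe]
    rw [← h2]
    exact Ideal.mem_map_of_mem _ (Ideal.mem_comap.2 (h1 ▸ I.mul_mem_left _ hf))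
  · rw [Ideal.mem_comap]
    by_cases h : map (IsLocalRing.residue (valRing v)) p = 0
    · rw [h]
      exact zero_mem _
    · rw [← initialForm_rescale hφ w p h]
      exact Ideal.subset_span ⟨_, hp, rfl⟩

theorem mem_initialIdeal_iff (hφ : IsSplitting v φ) {w : Fin (n + 1) → valueGroup v}
    {I : Ideal (MvPolynomial (Fin (n + 1)) K)} {g : MvPolynomial (Fin (n + 1)) (ResField v)} :
    g ∈ initialIdeal v φ w I ↔
      ∃ p, rescale φ w p ∈ I ∧ map (IsLocalRing.residue (valRing v)) p = g := by
  rw [initialIdeal_eq hφ, Ideal.mem_map_iff_of_surjective _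
    (map_surjective _ IsLocalRing.residue_surjective)]
  rfl

theorem exists_truncation_mem {I : Ideal (MvPolynomial (Fin (n + 1)) K)}
    (hI : IsHomogeneousIdeal I) {f : MvPolynomial (Fin (n + 1)) K} (hf : f ∈ I) (d : ℕ) :
    ∃ g ∈ I, ∀ u, coeff u g = if u.degree ≤ d then coeff u f else 0 := by
  classical
  refine ⟨∑ e ∈ Finset.range (d + 1), homogeneousComponent e f, I.sum_mem fun e _ => ?_,
    fun u => ?_⟩
  · rw [← decomposition.decompose'_apply]
    exact hI e hf
  · rw [coeff_sum]
    simp only [coeff_homogeneousComponent, Finset.sum_ite_eq, Finset.mem_range, Nat.lt_succ_iff]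

theorem trunc_initialIdeal (hφ : IsSplitting v φ) {I : Ideal (MvPolynomial (Fin (n + 1)) K)}
    (hI : IsHomogeneousIdeal I) (w : Fin (n + 1) → valueGroup v) (d : ℕ) :
    trunc d (initialIdeal v φ w I) =
      initialSpace v φ (trunc d I) fun u : Exponent n d => dot v w u.1 := by
  ext c
  constructor
  · rintro ⟨g, hg, hgd, hgc⟩
    obtain ⟨p, hp, rfl⟩ := (mem_initialIdeal_iff hφ).1 hg
    -- The lift `p` may have terms of degree above `d` that reduce to zero; homogeneity of `I`
    -- allows them to be discarded.
    obtain ⟨F, hF, hFp⟩ := exists_truncation_mem hI hp d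
    refine ⟨fun u => coeff u.1 p, ⟨F, hF, fun u hu => ?_, fun u => ?_⟩, fun u => ?_⟩
    · rw [hFp, if_neg hu.not_ge]
    · rw [hFp, if_pos u.2, coeff_rescale]
    · rw [← hgc, coeff_map]
  · rintro ⟨p, ⟨F, hF, hFd, hFp⟩, hc⟩
    obtain ⟨P, hPd, hP⟩ := exists_coeff_eq p
    have hPF : rescale φ w P = F := by
      ext u
      rw [coeff_rescale]
      by_cases hu : u.degree ≤ d
      · rw [hP ⟨u, hu⟩, hFp ⟨u, hu⟩]
      · rw [hPd u (not_le.1 hu), hFd u (not_le.1 hu)]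
        simp
    refine ⟨_, (mem_initialIdeal_iff hφ).2 ⟨P, hPF ▸ hF, rfl⟩, fun u hu => ?_, fun u => ?_⟩
    · rw [coeff_map, hPd u hu, map_zero]
    · rw [coeff_map, hP, hc]

/-- Initial ideals are determined by their truncations in a suitable degree. -/
theorem exists_trunc_initialIdeal_determines (hφ : IsSplitting v φ)
    {I : Ideal (MvPolynomial (Fin (n + 1)) K)} (hI : IsHomogeneousIdeal I) :
    ∃ d, ∀ w w', trunc d (initialIdeal v φ w I) = trunc d (initialIdeal v φ w' I) →
      initialIdeal v φ w I = initialIdeal v φ w' I := by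
  refine exists_trunc_determines (fun w => initialIdeal v φ w I) (fun d => ?_) fun d w w' => ?_
  · refine (finite_range_initialSpace hφ (trunc d I)).subset ?_
    rintro _ ⟨w, rfl⟩
    exact ⟨_, (trunc_initialIdeal hφ hI w d).symm⟩
  · rw [trunc_initialIdeal hφ hI, trunc_initialIdeal hφ hI, finrank_initialSpace hφ,
      finrank_initialSpace hφ]

/-! ### The tropical polynomial whose linearity complex is the Gröbner complex -/

variable {d : ℕ} (V : Submodule K (Exponent n d → K))

/-- The slope of the term with index `J` of the tropical polynomial of the Plücker coordinates. -/
noncomputable def pluckerSlope (J : PluckerIndex V) (i : Fin (n + 1)) : ℚ := ∑ j, ((J.1 j).1 i : ℚ)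

variable (v) in
/-- The constant of the term with index `J` of the tropical polynomial. -/
noncomputable def pluckerConstant (J : PluckerIndex V) : ℝ := (ord v (plucker V J.1) : ℝ)

theorem affineForm_plucker (w : Fin (n + 1) → valueGroup v) (J : PluckerIndex V) :
    affineForm (pluckerSlope V) (pluckerConstant v V) J (fun i => (w i : ℝ)) =
      (pluckerWeight v V (fun u : Exponent n d => dot v w u.1) J : ℝ) := by
  simp only [affineForm, pluckerSlope, pluckerConstant, pluckerWeight, dot, AddSubgroup.coe_add,
    AddSubgroup.val_finsetSum, AddSubgroup.coe_nsmul, nsmul_eq_mul]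
  push_cast
  simp only [Finset.sum_mul]
  rw [Finset.sum_comm]

theorem minSet_plucker (w : Fin (n + 1) → valueGroup v) :
    minSet (pluckerSlope V) (pluckerConstant v V) (fun i => (w i : ℝ)) =
      pluckerMin v V fun u : Exponent n d => dot v w u.1 := by
  ext J
  simp only [minSet, pluckerMin, Set.mem_ofPred_eq, affineForm_plucker, Subtype.coe_le_coe]

theorem initialIdeal_eq_iff_minSet_eq (hφ : IsSplitting v φ)
    {I : Ideal (MvPolynomial (Fin (n + 1)) K)} (hI : IsHomogeneousIdeal I)
    (hd : ∀ w w', trunc d (initialIdeal v φ w I) = trunc d (initialIdeal v φ w' I) →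
      initialIdeal v φ w I = initialIdeal v φ w' I) (w w' : Fin (n + 1) → valueGroup v) :
    initialIdeal v φ w I = initialIdeal v φ w' I ↔
      minSet (pluckerSlope (trunc d I)) (pluckerConstant v (trunc d I)) (fun i => (w i : ℝ)) =
        minSet (pluckerSlope (trunc d I)) (pluckerConstant v (trunc d I))
          (fun i => (w' i : ℝ)) := by
  rw [minSet_plucker, minSet_plucker, ← initialSpace_eq_iff hφ, ← trunc_initialIdeal hφ hI,
    ← trunc_initialIdeal hφ hI]
  exact ⟨fun h => by rw [h], hd w w'⟩

/-- Only weights in `Γ` define Gröbner cells, but every real point shares its minimum set with some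
`Γ`-point, so no cell of the linearity complex is missed. -/
theorem grobnerComplex_eq_range_linearityCell
    (h_rat : ∀ q : ℚ, (q : ℝ) ∈ valueGroup v)
    (h_div : ∀ γ ∈ valueGroup v, ∀ m : ℕ, 0 < m → γ / (m : ℝ) ∈ valueGroup v)
    (hφ : IsSplitting v φ)
    {I : Ideal (MvPolynomial (Fin (n + 1)) K)} (hI : IsHomogeneousIdeal I)
    (hd : ∀ w w', trunc d (initialIdeal v φ w I) = trunc d (initialIdeal v φ w' I) →
      initialIdeal v φ w I = initialIdeal v φ w' I) :
    grobnerComplex v φ I = Set.range fun y =>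
      linearityCell (pluckerSlope (trunc d I)) (pluckerConstant v (trunc d I))
        (minSet (pluckerSlope (trunc d I)) (pluckerConstant v (trunc d I)) y) := by
  have hb : ∀ J, pluckerConstant v (trunc d I) J ∈ valueGroup v := fun J => (ord v _).2
  have hcell : ∀ w : Fin (n + 1) → valueGroup v, closure (cell v φ I w) =
      linearityCell (pluckerSlope (trunc d I)) (pluckerConstant v (trunc d I))
        (minSet (pluckerSlope (trunc d I)) (pluckerConstant v (trunc d I))
          (fun i => (w i : ℝ))) := by
    intro w
    rw [← closure_minSet_eq (valueGroup v) h_rat h_div hb]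
    congr 1
    ext x
    constructor
    · rintro ⟨w', hx, h⟩
      obtain rfl : x = fun i => (w' i : ℝ) := funext hx
      exact ⟨fun i => (w' i).2, (initialIdeal_eq_iff_minSet_eq hφ hI hd w' w).1 h⟩
    · rintro ⟨hx, h⟩
      exact ⟨fun i => ⟨x i, hx i⟩, fun _ => rfl,
        (initialIdeal_eq_iff_minSet_eq hφ hI hd _ w).2 h⟩
  ext P
  constructor
  · rintro ⟨w, rfl⟩
    exact ⟨_, (hcell w).symm⟩
  · rintro ⟨y, rfl⟩
    obtain ⟨w, -, hw, hmin⟩ := exists_minSet_eq (a := pluckerSlope (trunc d I)) (valueGroup v)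
      h_rat h_div hb y Filter.univ_mem
    refine ⟨fun i => ⟨w i, hw i⟩, ?_⟩
    rw [hcell]
    simp only [hmin]

end InitialIdeal

end GrobnerComplex

/-! ### The Gröbner complex -/

theorem theoremt {K : Type*} [Field K] (v : AddValuation K (WithTop ℝ))
    (h_rat : ∀ q : ℚ, (q : ℝ) ∈ GrobnerComplex.valueGroup v)
    (h_div : ∀ γ ∈ GrobnerComplex.valueGroup v, ∀ m : ℕ, 0 < m →
      γ / (m : ℝ) ∈ GrobnerComplex.valueGroup v)
    (φ : Multiplicative (GrobnerComplex.valueGroup v) →* Kˣ)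
    (hφ : GrobnerComplex.IsSplitting v φ)
    (n : ℕ) (I : Ideal (MvPolynomial (Fin (n + 1)) K))
    (hI : GrobnerComplex.IsHomogeneousIdeal I) :
    (GrobnerComplex.grobnerComplex v φ I).Finite ∧
    GrobnerComplex.IsPolyhedralComplex (GrobnerComplex.grobnerComplex v φ I) ∧
    ∀ P ∈ GrobnerComplex.grobnerComplex v φ I,
      GrobnerComplex.IsRationalPolyhedron (GrobnerComplex.valueGroup v) P := by
  obtain ⟨d, hd⟩ := GrobnerComplex.exists_trunc_initialIdeal_determines hφ hI
  rw [GrobnerComplex.grobnerComplex_eq_range_linearityCell h_rat h_div hφ hI hd]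
  refine ⟨?_, GrobnerComplex.isPolyhedralComplex_linearityCell, ?_⟩
  -- Cells are indexed by subsets of the finite set of nonzero Plücker coordinates.
  · refine (Set.finite_range (GrobnerComplex.linearityCell
      (GrobnerComplex.pluckerSlope (GrobnerComplex.trunc d I))
      (GrobnerComplex.pluckerConstant v (GrobnerComplex.trunc d I)))).subset ?_
    rintro _ ⟨y, rfl⟩
    exact ⟨_, rfl⟩
  · rintro _ ⟨y, rfl⟩
    exact GrobnerComplex.isRationalPolyhedron_linearityCell _ (fun J => (GrobnerComplex.ord v _).2) _
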